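/- Let $n\ge 1$ and let $\phi:\mathbb R^n\to[0,\infty)$ be an anisotropy, i.e. a convex function with $\phi(\alpha y)=\alpha\phi(y)$ for all $\alpha>0$, $y\in\mathbb R^n$, and $\phi(y)=0$ if and only if $y=0$. Let $W_\phi=\{x\in\mathbb R^n : -x\cdot y\le\phi(y)\ \forall y\in\mathbb R^n\}$ be its Wulff shape. For a locally integrable $u:\mathbb R^n\to\mathbb R$ with distributional derivative $Du$, let $$\mathrm{TV}_\phi(u)=\int_{\mathbb R^n}\phi(\mathrm dDu)=\sup\Big\{-\int_{\mathbb R^n}u\,\nabla\cdot\varphi \;\Big|\; \varphi\in C^1_c(\mathbb R^n;\mathbb R^n),\ \varphi(x)\in -W_\phi\ \forall x\in\mathbb R^n\Big\}\in[0,\infty],$$ let $BV(\mathbb R^n)$ be the set of $u\in L^1(\mathbb R^n)$ with $\mathrm{TV}_{|\cdot|_2}(u)<\infty$, and for $\lambda>0$ put $E(u;f,\lambda)=\mathrm{TV}_\phi(u)+\lambda\|u-f\|_{L^1(\mathbb R^n)}\in[0,\infty]$. Write $\Sigma_u(t)=\{x\in\mathbb R^n: u(x)>t\}$ and $\chi_A$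 for the characteristic function of a set $A$. **Proposition.** Let $f\in L^1(\mathbb R^n)$, $\lambda>0$ and $u\in BV(\mathbb R^n)$. Then $t\mapsto E(\chi_{\Sigma_u(t)};\chi_{\Sigma_f(t)},\lambda)$ is Lebesgue measurable on $\mathbb R$, $E(u;f,\lambda)<\infty$, and $$E(u;f,\lambda)=\int_{-\infty}^{\infty}E(\chi_{\Sigma_u(t)};\chi_{\Sigma_f(t)},\lambda)\,\mathrm dt.$$ Moreover, $\chi_{\Sigma_u(t)}\notin L^1(\mathbb R^n)$ for every $t<0$, but $\|\chi_{\Sigma_u(t)}-\chi_{\Sigma_f(t)}\|_{L^1(\mathbb R^n)}=|\Sigma_u(t)\,\triangle\,\Sigma_f(t)|$ for every $t\in\mathbb R$, and this quantity is finite for almost every $t\in\mathbb R$. -/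

import Mathlib

open MeasureTheory
open scoped ENNReal Pointwise symmDiff

noncomputable section

namespace AnisoTV

/-- An anisotropy (gauge function) on `ℝⁿ`: a convex, nonnegative, positively 1-homogeneous
function that vanishes exactly at the origin. -/
structure IsAnisotropy {n : ℕ} (φ : EuclideanSpace ℝ (Fin n) → ℝ) : Prop where
  convexOn : ConvexOn ℝ Set.univ φ
  nonneg : ∀ y, 0 ≤ φ y
  map_smul : ∀ (a : ℝ), 0 < a → ∀ y, φ (a • y) = a * φ y
  eq_zero_iff : ∀ y, φ y = 0 ↔ y = 0

/-- The Wulff shape `W_φ = {x | -x · y ≤ φ y for all y}`. -/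
def wulffShape {n : ℕ} (φ : EuclideanSpace ℝ (Fin n) → ℝ) : Set (EuclideanSpace ℝ (Fin n)) :=
  {x | ∀ y, -(inner ℝ x y) ≤ φ y}

/-- The divergence of a (differentiable) vector field on `ℝⁿ`. -/
def divergence {n : ℕ} (v : EuclideanSpace ℝ (Fin n) → EuclideanSpace ℝ (Fin n))
    (x : EuclideanSpace ℝ (Fin n)) : ℝ :=
  ∑ i : Fin n, (fderiv ℝ v x (EuclideanSpace.single i 1)) i

/-- The pairing `∫ v · dDu = -∫ u div v` of the distributional derivative `Du` of a locally
integrable function `u` with a compactly supported `C¹` vector field `v`. -/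
def derivPairing {n : ℕ} (u : EuclideanSpace ℝ (Fin n) → ℝ)
    (v : EuclideanSpace ℝ (Fin n) → EuclideanSpace ℝ (Fin n)) : ℝ :=
  -∫ x, u x * divergence v x

/-- The fields `v ∈ C¹_c(ℝⁿ; ℝⁿ)` with values in `-W_φ`. -/
def testFields {n : ℕ} (φ : EuclideanSpace ℝ (Fin n) → ℝ) :
    Set (EuclideanSpace ℝ (Fin n) → EuclideanSpace ℝ (Fin n)) :=
  {v | ContDiff ℝ 1 v ∧ HasCompactSupport v ∧ ∀ x, v x ∈ -wulffShape φ}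

/-- The anisotropic total variation `TV_φ(u) = ∫ φ(dDu) ∈ [0, ∞]` of a locally integrable `u`:
the supremum of `∫ v · dDu` over the admissible fields. The field `0` is admissible, so the
truncation `ENNReal.ofReal` of negative values does not change the supremum. -/
def tv {n : ℕ} (φ : EuclideanSpace ℝ (Fin n) → ℝ) (u : EuclideanSpace ℝ (Fin n) → ℝ) : ℝ≥0∞ :=
  ⨆ v ∈ testFields φ, ENNReal.ofReal (derivPairing u v)

/-- `u ∈ BV(ℝⁿ)`: `u` is integrable and its isotropic total variation `TV_{|·|₂}(u)` is finite. -/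
def MemBV {n : ℕ} (u : EuclideanSpace ℝ (Fin n) → ℝ) : Prop :=
  Integrable u volume ∧ tv (fun y => ‖y‖) u < ∞

/-- The energy `E(u; f, lam) = TV_φ(u) + lam ‖u - f‖_{L¹}`, with values in `[0, ∞]`, so that it also
makes sense for locally integrable `u`, `f` that are not in `L¹`. -/
def energy {n : ℕ} (φ : EuclideanSpace ℝ (Fin n) → ℝ) (u f : EuclideanSpace ℝ (Fin n) → ℝ)
    (lam : ℝ) : ℝ≥0∞ :=
  tv φ u + ENNReal.ofReal lam * eLpNorm (fun x => u x - f x) 1 volume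

/-- The superlevel set `Σ_u(t) = {x | u x > t}`. -/
def superlevel {n : ℕ} (u : EuclideanSpace ℝ (Fin n) → ℝ) (t : ℝ) :
    Set (EuclideanSpace ℝ (Fin n)) :=
  {x | u x > t}

/-- The characteristic function `χ_A : ℝⁿ → ℝ` of a set `A`. -/
def chi {n : ℕ} (A : Set (EuclideanSpace ℝ (Fin n))) : EuclideanSpace ℝ (Fin n) → ℝ :=
  A.indicator (fun _ => 1)

end AnisoTV

end

namespace AnisoTV

open Filter Topology Function

variable {n : ℕ} {φ : EuclideanSpace ℝ (Fin n) → ℝ}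
  {f g u : EuclideanSpace ℝ (Fin n) → ℝ}
  {v : EuclideanSpace ℝ (Fin n) → EuclideanSpace ℝ (Fin n)}

/-! ### Divergence and the pairing -/

/-! The energy splits into two layer-cake formulas. For the fidelity term it is Tonelli together
with `∫ |χ_{a>t} - χ_{b>t}| dt = |a - b|` (`lintegral_eLpNorm_chi_sub`). For the total variation it
is the coarea formula, proved as two inequalities. The bound `tv_le_lintegral_tv_chi` comes from
writing the pairing of `u` with a test field as the integral over `t` of the pairings of its
superlevel sets. The converse `lintegral_tv_chi_le` rests on superadditivity (`sum_tv_comp_le`): if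
the slopes of the truncations `S i` are nonnegative with sum at most one, the variations of `S i ∘
u` add up to at most that of `u`. Indeed, fields `w i` that are nearly optimal for the pieces glue
to the single admissible field `∑ η i (u) • w i`; mollification makes the chain rule legitimate.
Truncations to overlapping bands of height comparable to `r` bound Riemann sums of mesh `r`;
averaging over the offset gives an integral bound, and `r → 0` turns the truncations into
characteristic functions, with Fatou and lower semicontinuity preserving the bound. -/

lemma continuous_divergence (hv : ContDiff ℝ 1 v) : Continuous (divergence v) := by
  have h : Continuous (fderiv ℝ v) := hv.continuous_fderiv one_ne_zero
  unfold divergence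
  fun_prop

lemma hasCompactSupport_divergence (hv : HasCompactSupport v) :
    HasCompactSupport (divergence v) := by
  have h := hv.fderiv (𝕜 := ℝ)
  refine h.comp_left (g := fun L : EuclideanSpace ℝ (Fin n) →L[ℝ] EuclideanSpace ℝ (Fin n) =>
    ∑ i : Fin n, (L (EuclideanSpace.single i 1)) i) ?_
  simp

lemma integrable_divergence (hv : ContDiff ℝ 1 v) (hc : HasCompactSupport v) :
    Integrable (divergence v) volume :=
  (continuous_divergence hv).integrable_of_hasCompactSupport (hasCompactSupport_divergence hc)

lemma exists_abs_divergence_le (hv : ContDiff ℝ 1 v) (hc : HasCompactSupport v) :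
    ∃ C, ∀ x, |divergence v x| ≤ C :=
  (hasCompactSupport_divergence hc).exists_bound_of_continuous (continuous_divergence hv)

lemma integrable_mul_divergence (hg : Integrable g volume) (hv : ContDiff ℝ 1 v)
    (hc : HasCompactSupport v) : Integrable (fun x => g x * divergence v x) volume := by
  obtain ⟨C, hC⟩ := exists_abs_divergence_le hv hc
  exact hg.mul_bdd (c := C) (continuous_divergence hv).aestronglyMeasurable (ae_of_all _ hC)

lemma integrable_bdd_mul_divergence {M : ℝ} (hg : AEStronglyMeasurable g volume)
    (hM : ∀ x, |g x| ≤ M) (hv : ContDiff ℝ 1 v) (hc : HasCompactSupport v) :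
    Integrable (fun x => g x * divergence v x) volume :=
  (integrable_divergence hv hc).bdd_mul (c := M) hg (ae_of_all _ hM)

lemma fderiv_apply_coord (hv : ContDiff ℝ 1 v) (i : Fin n) (x y : EuclideanSpace ℝ (Fin n)) :
    fderiv ℝ (fun x => v x i) x y = (fderiv ℝ v x y) i := by
  have h : HasFDerivAt v (fderiv ℝ v x) x := (hv.differentiable one_ne_zero x).hasFDerivAt
  have h2 := (EuclideanSpace.proj (𝕜 := ℝ) i).hasFDerivAt.comp x h
  have h3 : fderiv ℝ (fun x => v x i) x = (EuclideanSpace.proj (𝕜 := ℝ) i).comp (fderiv ℝ v x) :=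
    h2.fderiv
  rw [h3]; rfl

/-- Integration by parts for a `C¹` function. -/
lemma derivPairing_eq_integral_fderiv (hg : ContDiff ℝ 1 g) (hv : ContDiff ℝ 1 v)
    (hc : HasCompactSupport v) : derivPairing g v = ∫ x, fderiv ℝ g x (v x) := by
  have hgc := hg.continuous
  have hg' : Continuous (fderiv ℝ g) := hg.continuous_fderiv one_ne_zero
  have hv' : Continuous (fderiv ℝ v) := hv.continuous_fderiv one_ne_zero
  have hvi (i : Fin n) : ContDiff ℝ 1 (fun x => v x i) := by fun_prop
  have hvic (i : Fin n) : HasCompactSupport (fun x => v x i) :=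
    hc.comp_left (g := fun y : EuclideanSpace ℝ (Fin n) => y i) rfl
  have hvi' (i : Fin n) (y) : HasCompactSupport (fun x => fderiv ℝ (fun x => v x i) x y) :=
    ((hvic i).fderiv (𝕜 := ℝ)).comp_left
      (g := fun L : EuclideanSpace ℝ (Fin n) →L[ℝ] ℝ => L y) rfl
  have hvid (i : Fin n) : Continuous (fderiv ℝ fun x => v x i) :=
    (hvi i).continuous_fderiv one_ne_zero
  have hA (i : Fin n) : Integrable
      (fun x => g x * fderiv ℝ (fun x => v x i) x (EuclideanSpace.single i 1)) volume :=
    Continuous.integrable_of_hasCompactSupport (by fun_prop) (hvi' i _).mul_left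
  have hB (i : Fin n) : Integrable
      (fun x => fderiv ℝ g x (EuclideanSpace.single i 1) * v x i) volume :=
    Continuous.integrable_of_hasCompactSupport
      (by have := (hvi i).continuous; fun_prop) (hvic i).mul_left
  have hC (i : Fin n) : Integrable (fun x => g x * v x i) volume :=
    Continuous.integrable_of_hasCompactSupport
      (by have := (hvi i).continuous; fun_prop) (hvic i).mul_left
  have key (i : Fin n) := integral_mul_fderiv_eq_neg_fderiv_mul_of_integrable (hB i) (hA i) (hC i)
    (fun x _ => hg.differentiable one_ne_zero x) (fun x _ => (hvi i).differentiable one_ne_zero x)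
  have h1 : (fun x => g x * divergence v x) = fun x => ∑ i : Fin n,
      g x * fderiv ℝ (fun x => v x i) x (EuclideanSpace.single i 1) := by
    funext x
    simp_rw [fderiv_apply_coord hv, divergence, Finset.mul_sum]
  have h2 : (fun x => fderiv ℝ g x (v x)) = fun x => ∑ i : Fin n,
      fderiv ℝ g x (EuclideanSpace.single i 1) * v x i := by
    funext x
    conv_lhs => rw [← (EuclideanSpace.basisFun (Fin n) ℝ).sum_repr (v x)]
    simp [map_sum, mul_comm]
  unfold derivPairing
  rw [h1, h2, integral_finsetSum _ fun i _ => hA i, integral_finsetSum _ fun i _ => hB i,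
    ← Finset.sum_neg_distrib]
  exact Finset.sum_congr rfl fun i _ => by rw [key, neg_neg]

/-- This makes the pairing blind to additive constants, which the layer-cake formula needs at
negative levels. -/
lemma integral_divergence_eq_zero (hv : ContDiff ℝ 1 v) (hc : HasCompactSupport v) :
    ∫ x, divergence v x = 0 := by
  have h := derivPairing_eq_integral_fderiv (g := fun _ => 1) contDiff_const hv hc
  simpa [derivPairing] using h

lemma derivPairing_congr_ae {g' : EuclideanSpace ℝ (Fin n) → ℝ} (h : g =ᵐ[volume] g') :
    derivPairing g v = derivPairing g' v := by
  unfold derivPairing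
  congr 1
  exact integral_congr_ae (h.mono fun x hx => by simp [hx])

lemma tv_congr_ae {g' : EuclideanSpace ℝ (Fin n) → ℝ} (h : g =ᵐ[volume] g') :
    tv φ g = tv φ g' := by
  unfold tv
  simp_rw [derivPairing_congr_ae h]

/-! ### Test fields -/

lemma mem_neg_wulffShape {y : EuclideanSpace ℝ (Fin n)} :
    y ∈ -wulffShape φ ↔ ∀ z, inner ℝ y z ≤ φ z := by
  simp [wulffShape, inner_neg_left]

lemma zero_mem_testFields (hφ : IsAnisotropy φ) : 0 ∈ testFields φ := by
  refine ⟨contDiff_const, HasCompactSupport.zero, fun x => mem_neg_wulffShape.2 fun z => ?_⟩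
  simpa using hφ.nonneg z

lemma ofReal_derivPairing_le_tv (hv : v ∈ testFields φ) :
    ENNReal.ofReal (derivPairing g v) ≤ tv φ g :=
  le_iSup₂ (f := fun v (_ : v ∈ testFields φ) => ENNReal.ofReal (derivPairing g v)) v hv

lemma derivPairing_le_toReal_tv (hg : tv φ g ≠ ∞) (hv : v ∈ testFields φ) :
    derivPairing g v ≤ (tv φ g).toReal :=
  (ENNReal.ofReal_le_iff_le_toReal hg).1 (ofReal_derivPairing_le_tv hv)

lemma comp_add_mem_testFields (hv : v ∈ testFields φ) (z : EuclideanSpace ℝ (Fin n)) :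
    (fun x => v (x + z)) ∈ testFields φ :=
  ⟨hv.1.comp (by fun_prop), hv.2.1.comp_homeomorph (Homeomorph.addRight z), fun x => hv.2.2 _⟩

lemma derivPairing_comp_sub (z : EuclideanSpace ℝ (Fin n)) :
    derivPairing (fun x => g (x - z)) v = derivPairing g (fun x => v (x + z)) := by
  unfold derivPairing
  rw [← integral_add_right_eq_self _ z]
  simp [divergence, fderiv_comp_add_right]

/-- A combination of test fields with nonnegative weights of sum at most one is a test field. -/
lemma sum_smul_mem_testFields {ι : Type*} (hφ : IsAnisotropy φ) (s : Finset ι)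
    {c : ι → EuclideanSpace ℝ (Fin n) → ℝ}
    {w : ι → EuclideanSpace ℝ (Fin n) → EuclideanSpace ℝ (Fin n)}
    (hw : ∀ i ∈ s, w i ∈ testFields φ) (hc : ∀ i ∈ s, ContDiff ℝ 1 (c i))
    (hc0 : ∀ i ∈ s, ∀ x, 0 ≤ c i x) (hc1 : ∀ x, ∑ i ∈ s, c i x ≤ 1) :
    (fun x => ∑ i ∈ s, c i x • w i x) ∈ testFields φ := by
  refine ⟨ContDiff.sum fun i hi => (hc i hi).smul (hw i hi).1, ?_, fun x => ?_⟩
  · have hK : IsCompact (⋃ i ∈ s, tsupport (w i)) :=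
      s.isCompact_biUnion fun i hi => (hw i hi).2.1
    refine HasCompactSupport.intro hK fun x hx => Finset.sum_eq_zero fun i hi => ?_
    have : x ∉ tsupport (w i) := fun h => hx (Set.mem_biUnion hi h)
    rw [image_eq_zero_of_notMem_tsupport this, smul_zero]
  · refine mem_neg_wulffShape.2 fun z => ?_
    rw [sum_inner]
    calc ∑ i ∈ s, inner ℝ (c i x • w i x) z ≤ ∑ i ∈ s, c i x * φ z := by
          refine Finset.sum_le_sum fun i hi => ?_
          rw [real_inner_smul_left]
          exact mul_le_mul_of_nonneg_left (mem_neg_wulffShape.1 ((hw i hi).2.2 x) z) (hc0 i hi x)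
      _ = (∑ i ∈ s, c i x) * φ z := (Finset.sum_mul ..).symm
      _ ≤ 1 * φ z := mul_le_mul_of_nonneg_right (hc1 x) (hφ.nonneg z)
      _ = φ z := one_mul _

/-! ### Comparison with the isotropic total variation -/

lemma IsAnisotropy.exists_le_mul_norm (hφ : IsAnisotropy φ) :
    ∃ C, 0 < C ∧ ∀ y, φ y ≤ C * ‖y‖ := by
  have hcont : Continuous φ := by
    rw [← continuousOn_univ]
    exact hφ.convexOn.continuousOn isOpen_univ
  obtain ⟨C, hC⟩ := (isCompact_sphere (0 : EuclideanSpace ℝ (Fin n)) 1).exists_bound_of_continuousOn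
    hcont.continuousOn
  -- The bound `C` on the sphere need not be positive; the maximum makes the constant safe to divide
  -- by.
  refine ⟨max C 1, by positivity, fun y => ?_⟩
  by_cases hy : y = 0
  · simp [hy, (hφ.eq_zero_iff 0).2 rfl]
  have hy' : 0 < ‖y‖ := norm_pos_iff.2 hy
  have h1 : φ y = ‖y‖ * φ (‖y‖⁻¹ • y) := by
    rw [← hφ.map_smul _ hy', smul_smul, mul_inv_cancel₀ hy'.ne', one_smul]
  have h2 : φ (‖y‖⁻¹ • y) ≤ C :=
    (Real.le_norm_self _).trans (hC _ (by simp [norm_smul, hy'.ne']))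
  rw [h1, mul_comm]
  exact mul_le_mul_of_nonneg_right (h2.trans (le_max_left _ _)) hy'.le

/-- Since `φ ≤ C ‖·‖`, fields admissible for `φ` become admissible for the norm after division by
`C`. -/
lemma tv_lt_top_of_memBV (hφ : IsAnisotropy φ) (hu : MemBV u) : tv φ u < ∞ := by
  obtain ⟨C, hC, hle⟩ := hφ.exists_le_mul_norm
  refine lt_of_le_of_lt (b := ENNReal.ofReal C * tv (fun y => ‖y‖) u) ?_
    (ENNReal.mul_lt_top ENNReal.ofReal_lt_top hu.2)
  refine iSup₂_le fun v hv => ?_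
  have hmem : (fun x => C⁻¹ • v x) ∈ testFields (fun y : EuclideanSpace ℝ (Fin n) => ‖y‖) := by
    refine ⟨hv.1.const_smul _, hv.2.1.comp_left (g := fun y => C⁻¹ • y) (smul_zero _), fun x => ?_⟩
    refine mem_neg_wulffShape.2 fun z => ?_
    rw [real_inner_smul_left, inv_mul_le_iff₀ hC]
    exact (mem_neg_wulffShape.1 (hv.2.2 x) z).trans (hle z)
  have hp : derivPairing u v = C * derivPairing u (fun x => C⁻¹ • v x) := by
    have hd (x) : divergence (fun x => C⁻¹ • v x) x = C⁻¹ * divergence v x := by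
      have : fderiv ℝ (fun x => C⁻¹ • v x) x = C⁻¹ • fderiv ℝ v x :=
        fderiv_fun_const_smul (hv.1.differentiable one_ne_zero x) _
      simp [divergence, this, Finset.mul_sum]
    unfold derivPairing
    simp_rw [hd, mul_left_comm _ C⁻¹, integral_const_mul]
    field_simp
  rw [hp, ENNReal.ofReal_mul hC.le]
  gcongr
  exact ofReal_derivPairing_le_tv hmem

/-! ### Measurability and lower semicontinuity -/

lemma derivPairing_sub_le {M : ℝ} {w : EuclideanSpace ℝ (Fin n) → EuclideanSpace ℝ (Fin n)}
    (hg : AEStronglyMeasurable g volume) (hM : ∀ x, |g x| ≤ M)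
    (hv : v ∈ testFields φ) (hw : w ∈ testFields φ) :
    derivPairing g v - derivPairing g w ≤ M * ∫ x, |divergence v x - divergence w x| := by
  have h1 := integrable_bdd_mul_divergence hg hM hv.1 hv.2.1
  have h2 := integrable_bdd_mul_divergence hg hM hw.1 hw.2.1
  have h3 : Integrable (fun x => |divergence v x - divergence w x|) volume :=
    ((integrable_divergence hv.1 hv.2.1).sub (integrable_divergence hw.1 hw.2.1)).abs
  have h4 : derivPairing g v - derivPairing g w =
      ∫ x, (g x * divergence w x - g x * divergence v x) := by
    rw [integral_sub h2 h1, derivPairing, derivPairing]; ring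
  rw [h4, ← integral_const_mul]
  refine integral_mono (h2.sub h1) (h3.const_mul M) fun x => ?_
  calc g x * divergence w x - g x * divergence v x
      ≤ |g x * (divergence w x - divergence v x)| := by rw [mul_sub]; exact le_abs_self _
    _ = |g x| * |divergence v x - divergence w x| := by rw [abs_mul, abs_sub_comm]
    _ ≤ M * |divergence v x - divergence w x| := by gcongr; exact hM x

/-- On bounded functions, countably many test fields suffice to compute the total variation. -/
lemma exists_countable_tv_eq (φ : EuclideanSpace ℝ (Fin n) → ℝ) :
    ∃ C : Set (EuclideanSpace ℝ (Fin n) → EuclideanSpace ℝ (Fin n)), C.Countable ∧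
      C ⊆ testFields φ ∧ ∀ (g : EuclideanSpace ℝ (Fin n) → ℝ) (M : ℝ),
        AEStronglyMeasurable g volume → (∀ x, |g x| ≤ M) →
        tv φ g = ⨆ v ∈ C, ENNReal.ofReal (derivPairing g v) := by
  have hint (v : testFields φ) : Integrable (divergence v.1) volume :=
    integrable_divergence v.2.1 v.2.2.1
  -- A field enters the pairing only through its divergence, and `L¹` is separable: countably many
  -- divergences are dense among all admissible ones.
  let D : testFields φ → Lp ℝ 1 (volume : Measure (EuclideanSpace ℝ (Fin n))) :=
    fun v => (hint v).toL1 _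
  have : Fact ((1 : ℝ≥0∞) ≠ ∞) := ⟨ENNReal.one_ne_top⟩
  obtain ⟨T, hTs, hTc, hTd⟩ :=
    (TopologicalSpace.IsSeparable.of_separableSpace (Set.range D)).exists_countable_dense_subset
  choose sec hsec using fun ℓ : T => hTs ℓ.2
  have := hTc.to_subtype
  refine ⟨Set.range fun ℓ => (sec ℓ).1, Set.countable_range _,
    Set.range_subset_iff.2 fun ℓ => (sec ℓ).2, fun g M hg hM => ?_⟩
  apply le_antisymm
  · refine iSup₂_le fun v hv => ENNReal.le_of_forall_pos_le_add fun ε hε _ => ?_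
    have hM0 : 0 ≤ M := (abs_nonneg _).trans (hM 0)
    -- `M + 1` rather than `M`, which may vanish.
    have hδ : 0 < (ε : ℝ) / (M + 1) := by positivity
    obtain ⟨ℓ, hℓT, hℓ⟩ := Metric.mem_closure_iff.1 (hTd ⟨⟨v, hv⟩, rfl⟩) _ hδ
    set w := sec ⟨ℓ, hℓT⟩ with hw
    have hdist : ∫ x, |divergence v x - divergence w.1 x| ≤ ε / (M + 1) := by
      rw [← show D w = ℓ from hsec ⟨ℓ, hℓT⟩, dist_eq_norm, ← Integrable.toL1_sub,
        L1.norm_of_fun_eq_integral_norm] at hℓ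
      exact hℓ.le
    have hle : derivPairing g v ≤ derivPairing g w.1 + ε := by
      have h1 := derivPairing_sub_le hg hM hv w.2
      have h2 : M * ∫ x, |divergence v x - divergence w.1 x| ≤ ε := by
        refine (mul_le_mul_of_nonneg_left hdist hM0).trans ?_
        rw [mul_div_assoc', div_le_iff₀ (by positivity)]
        nlinarith [ε.2]
      linarith
    calc ENNReal.ofReal (derivPairing g v)
        ≤ ENNReal.ofReal (derivPairing g w.1 + ε) := ENNReal.ofReal_le_ofReal hle
      _ ≤ ENNReal.ofReal (derivPairing g w.1) + ENNReal.ofReal ε := ENNReal.ofReal_add_le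
      _ ≤ _ := by
        rw [ENNReal.ofReal_coe_nnreal]
        gcongr
        exact le_iSup₂ (f := fun v (_ : v ∈ Set.range fun ℓ => (sec ℓ).1) =>
          ENNReal.ofReal (derivPairing g v)) w.1 ⟨⟨ℓ, hℓT⟩, rfl⟩
  · refine iSup₂_le fun v hv => ofReal_derivPairing_le_tv ?_
    obtain ⟨ℓ, rfl⟩ := hv
    exact (sec ℓ).2

lemma measurable_derivPairing {G : ℝ → EuclideanSpace ℝ (Fin n) → ℝ}
    (hG : Measurable (uncurry G)) (hv : ContDiff ℝ 1 v) :
    Measurable fun t => derivPairing (G t) v := by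
  have h : StronglyMeasurable (uncurry fun t x => G t x * divergence v x) :=
    (hG.mul ((continuous_divergence hv).measurable.comp measurable_snd)).stronglyMeasurable
  exact h.integral_prod_right.measurable.neg

/-- An uncountable supremum of measurable functions need not be measurable; the uniform bound allows
a countable one. -/
lemma measurable_tv {G : ℝ → EuclideanSpace ℝ (Fin n) → ℝ} {M : ℝ}
    (hG : Measurable (uncurry G)) (hM : ∀ t x, |G t x| ≤ M) :
    Measurable fun t => tv φ (G t) := by
  obtain ⟨C, hCc, hCs, hC⟩ := exists_countable_tv_eq φ
  have h (t) : tv φ (G t) = ⨆ v ∈ C, ENNReal.ofReal (derivPairing (G t) v) :=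
    hC (G t) M (hG.comp measurable_prodMk_left).aestronglyMeasurable (hM t)
  simp_rw [h]
  exact Measurable.biSup C hCc fun v hv =>
    (measurable_derivPairing hG (hCs hv).1).ennreal_ofReal

lemma tendsto_derivPairing {G : ℕ → EuclideanSpace ℝ (Fin n) → ℝ} {M : ℝ}
    (hG : ∀ k, AEStronglyMeasurable (G k) volume) (hM : ∀ k x, |G k x| ≤ M)
    (hlim : ∀ᵐ x, Tendsto (fun k => G k x) atTop (𝓝 (g x)))
    (hv : ContDiff ℝ 1 v) (hc : HasCompactSupport v) :
    Tendsto (fun k => derivPairing (G k) v) atTop (𝓝 (derivPairing g v)) := by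
  refine Tendsto.neg ?_
  refine tendsto_integral_of_dominated_convergence (fun x => M * |divergence v x|)
    (fun k => (hG k).mul (continuous_divergence hv).aestronglyMeasurable)
    ((integrable_divergence hv hc).abs.const_mul M) (fun k => ae_of_all _ fun x => ?_) ?_
  · rw [Real.norm_eq_abs, abs_mul]
    gcongr
    exact hM k x
  · filter_upwards [hlim] with x hx using hx.mul_const _

lemma tv_le_liminf {G : ℕ → EuclideanSpace ℝ (Fin n) → ℝ} {M : ℝ}
    (hG : ∀ k, AEStronglyMeasurable (G k) volume) (hM : ∀ k x, |G k x| ≤ M)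
    (hlim : ∀ᵐ x, Tendsto (fun k => G k x) atTop (𝓝 (g x))) :
    tv φ g ≤ liminf (fun k => tv φ (G k)) atTop := by
  refine iSup₂_le fun v hv => ?_
  have h := ENNReal.tendsto_ofReal (tendsto_derivPairing hG hM hlim hv.1 hv.2.1)
  rw [← h.liminf_eq]
  exact liminf_le_liminf (Eventually.of_forall fun k => ofReal_derivPairing_le_tv hv)

/-! ### Mollification -/

open scoped Convolution in
/-- Mollification does not increase the total variation. -/
lemma derivPairing_convolution_le (hu : Integrable u volume) (htv : tv φ u ≠ ∞)
    {ρ : EuclideanSpace ℝ (Fin n) → ℝ} (hρ : Integrable ρ volume) (hρ0 : ∀ z, 0 ≤ ρ z)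
    (hρ1 : ∫ z, ρ z = 1) (hv : v ∈ testFields φ) :
    derivPairing (ρ ⋆[ContinuousLinearMap.lsmul ℝ ℝ, volume] u) v ≤ (tv φ u).toReal := by
  obtain ⟨C, hC⟩ := exists_abs_divergence_le hv.1 hv.2.1
  have hint : Integrable (fun p : EuclideanSpace ℝ (Fin n) × EuclideanSpace ℝ (Fin n) =>
      ρ p.2 * u (p.1 - p.2) * divergence v p.1) (volume.prod volume) := by
    have h := hρ.convolution_integrand (ContinuousLinearMap.lsmul ℝ ℝ) hu
    exact h.mul_bdd (c := C)
      ((continuous_divergence hv.1).comp continuous_fst).aestronglyMeasurable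
      (ae_of_all _ fun p => hC _)
  -- A mollification is an average of translates, and a translation can be moved onto the test
  -- field, which stays admissible.
  have h1 : derivPairing (ρ ⋆[ContinuousLinearMap.lsmul ℝ ℝ, volume] u) v =
      ∫ z, ρ z * derivPairing u (fun x => v (x + z)) := by
    simp_rw [← derivPairing_comp_sub]
    unfold derivPairing convolution
    simp_rw [← integral_mul_const, mul_neg, integral_neg, ← integral_const_mul]
    congr 1
    rw [integral_integral_swap]
    · simp [mul_assoc]
    · exact hint
  have h2 : Integrable (fun z => ρ z * derivPairing u (fun x => v (x + z))) volume := by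
    have h := hint.swap.integral_prod_left.neg
    refine h.congr (ae_of_all _ fun z => ?_)
    simp_rw [← derivPairing_comp_sub, derivPairing, mul_neg, ← integral_const_mul]
    simp [mul_assoc]
  calc _ = ∫ z, ρ z * derivPairing u (fun x => v (x + z)) := h1
    _ ≤ ∫ z, ρ z * (tv φ u).toReal := by
      refine integral_mono h2 (hρ.mul_const _) fun z => ?_
      exact mul_le_mul_of_nonneg_left
        (derivPairing_le_toReal_tv htv (comp_add_mem_testFields hv z)) (hρ0 z)
    _ = (tv φ u).toReal := by rw [integral_mul_const, hρ1, one_mul]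

/-- An integrable function of finite total variation is approximated almost everywhere by `C¹`
functions of no larger total variation. -/
lemma exists_contDiff_tendsto (hu : Integrable u volume) (htv : tv φ u ≠ ∞) :
    ∃ w : ℕ → EuclideanSpace ℝ (Fin n) → ℝ, (∀ k, ContDiff ℝ 1 (w k)) ∧
      (∀ᵐ x, Tendsto (fun k => w k x) atTop (𝓝 (u x))) ∧
      ∀ k, ∀ v ∈ testFields φ, derivPairing (w k) v ≤ (tv φ u).toReal := by
  -- The fixed ratio 2 of the radii is the constant `K` in the almost-everywhere convergence below.
  let ρ : ℕ → ContDiffBump (0 : EuclideanSpace ℝ (Fin n)) := fun k =>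
    { rIn := 1 / ((k : ℝ) + 1)
      rOut := 2 * (1 / ((k : ℝ) + 1))
      rIn_pos := by positivity
      rIn_lt_rOut := by
        have : 0 < 1 / ((k : ℝ) + 1) := by positivity
        linarith }
  have hlim : Tendsto (fun k => (ρ k).rOut) atTop (𝓝 0) := by
    simpa [ρ] using (tendsto_one_div_add_atTop_nhds_zero_nat (𝕜 := ℝ)).const_mul 2
  refine ⟨fun k => convolution ((ρ k).normed volume) u (ContinuousLinearMap.lsmul ℝ ℝ) volume,
    fun k => ?_, ?_, fun k v hv => ?_⟩
  · exact (ρ k).hasCompactSupport_normed.contDiff_convolution_left (n := 1) _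
      (ρ k).contDiff_normed hu.locallyIntegrable
  · exact ContDiffBump.ae_convolution_tendsto_right_of_locallyIntegrable (K := 2) hlim
      (Eventually.of_forall fun k => le_rfl) hu.locallyIntegrable
  · exact derivPairing_convolution_le hu htv (ρ k).integrable_normed (ρ k).nonneg_normed
      (ρ k).integral_normed hv

/-! ### Smooth truncations -/

/-- A `C²` function increasing from `0` on `(-∞, 0]` to `1` on `[2, ∞)` whose derivative generates
a partition of unity by integer translations. -/
noncomputable def smoothStep (y : ℝ) : ℝ := ∫ x in (y - 1)..y, Real.smoothTransition x

lemma hasDerivAt_smoothStep (y : ℝ) :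
    HasDerivAt smoothStep (Real.smoothTransition y - Real.smoothTransition (y - 1)) y := by
  have hi (a b : ℝ) : IntervalIntegrable Real.smoothTransition volume a b :=
    Real.smoothTransition.continuous.intervalIntegrable a b
  have hF (z : ℝ) : HasDerivAt (fun z => ∫ x in (0 : ℝ)..z, Real.smoothTransition x)
      (Real.smoothTransition z) z :=
    Real.smoothTransition.continuous.integral_hasStrictDerivAt 0 z |>.hasDerivAt
  have h := (hF y).sub ((hF (y - 1)).comp_sub_const y 1)
  refine h.congr_of_eventuallyEq (Eventually.of_forall fun z => ?_)
  exact (intervalIntegral.integral_interval_sub_left (hi 0 z) (hi 0 (z - 1))).symm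

lemma continuous_smoothStep : Continuous smoothStep :=
  continuous_iff_continuousAt.2 fun y => (hasDerivAt_smoothStep y).continuousAt

lemma smoothStep_of_nonpos {y : ℝ} (hy : y ≤ 0) : smoothStep y = 0 := by
  have h : smoothStep y = ∫ x in (y - 1)..y, (0 : ℝ) := by
    refine intervalIntegral.integral_congr fun x hx => ?_
    rw [Set.uIcc_of_le (by linarith)] at hx
    exact Real.smoothTransition.zero_of_nonpos (hx.2.trans hy)
  simpa using h

lemma smoothStep_of_two_le {y : ℝ} (hy : 2 ≤ y) : smoothStep y = 1 := by
  have h : smoothStep y = ∫ x in (y - 1)..y, (1 : ℝ) := by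
    refine intervalIntegral.integral_congr fun x hx => ?_
    rw [Set.uIcc_of_le (by linarith)] at hx
    exact Real.smoothTransition.one_of_one_le (by linarith [hx.1])
  simpa using h

lemma abs_smoothStep_le (y : ℝ) : |smoothStep y| ≤ 1 := by
  have h := intervalIntegral.norm_integral_le_of_norm_le_const (a := y - 1) (b := y) (C := 1)
    (f := Real.smoothTransition) fun x _ => by
      rw [Real.norm_eq_abs, abs_of_nonneg (Real.smoothTransition.nonneg x)]
      exact Real.smoothTransition.le_one x
  simpa [smoothStep] using h

/-- As `smoothStep` vanishes at 0, the limit at `a = t` is 0, in agreement with the strict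
inequality in `superlevel`. -/
lemma tendsto_smoothStep_div (a t : ℝ) {r : ℕ → ℝ} (hr : ∀ k, 0 < r k)
    (hr0 : Tendsto r atTop (𝓝 0)) :
    Tendsto (fun k => smoothStep ((a - t) / r k)) atTop
      (𝓝 ((Set.Ioi t).indicator (fun _ => 1) a)) := by
  by_cases h : a ∈ Set.Ioi t
  · rw [Set.indicator_of_mem h]
    refine tendsto_const_nhds.congr' ?_
    have h' : 0 < (a - t) / 2 := by linarith [Set.mem_Ioi.1 h]
    filter_upwards [hr0.eventually (gt_mem_nhds h')] with k hk
    exact (smoothStep_of_two_le (by rw [le_div_iff₀ (hr k)]; linarith)).symm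
  · rw [Set.indicator_of_notMem h]
    refine tendsto_const_nhds.congr fun k => (smoothStep_of_nonpos ?_).symm
    exact div_nonpos_of_nonpos_of_nonneg (by linarith [Set.notMem_Ioi.1 h]) (hr k).le

lemma sum_smoothTransition_sub_le (y : ℝ) (s : Finset ℤ) :
    ∑ i ∈ s, (Real.smoothTransition (y - i) - Real.smoothTransition (y - i - 1)) ≤ 1 := by
  set F : ℤ → ℝ := fun i => Real.smoothTransition (y - i) with hF
  have hmono (i : ℤ) : F (i + 1) ≤ F i :=
    Real.smoothTransition.monotone (by push_cast; linarith)
  have hrange (a : ℤ) (N : ℕ) :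
      ∑ i ∈ Finset.Ico a (a + N), (F i - F (i + 1)) = F a - F (a + N) := by
    induction N with
    | zero => simp
    | succ N ih =>
      have : Finset.Ico a (a + (N + 1 : ℕ)) = insert (a + N) (Finset.Ico a (a + N)) := by
        ext i; simp only [Finset.mem_Ico, Finset.mem_insert]; omega
      rw [this, Finset.sum_insert (by simp), ih]
      push_cast
      rw [add_assoc]
      ring
  obtain ⟨a, ha⟩ := s.bddBelow
  obtain ⟨b, hb⟩ := s.bddAbove
  -- The summands are nonnegative, so `s` may be enlarged to an integer interval, where the sum
  -- telescopes.
  have hsub : s ⊆ Finset.Ico a (a + ((b + 1 - a).toNat : ℕ)) := fun i hi => by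
    have h1 := ha hi
    have h2 := hb hi
    simp only [Finset.mem_Ico]
    omega
  calc ∑ i ∈ s, (Real.smoothTransition (y - i) - Real.smoothTransition (y - i - 1))
      = ∑ i ∈ s, (F i - F (i + 1)) := by simp [hF, sub_sub]
    _ ≤ _ := Finset.sum_le_sum_of_subset_of_nonneg hsub fun i _ _ => sub_nonneg.2 (hmono i)
    _ = _ := hrange _ _
    _ ≤ 1 := by
      linarith [Real.smoothTransition.le_one (y - a),
        Real.smoothTransition.nonneg (y - ((a + ((b + 1 - a).toNat : ℕ) : ℤ) : ℝ))]

/-! ### Superadditivity under smooth truncations -/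

lemma sum_derivPairing_comp_le {ι : Type*} (hφ : IsAnisotropy φ) (hu : Integrable u volume)
    (htv : tv φ u ≠ ∞) (s : Finset ι) {S η : ι → ℝ → ℝ} {M : ℝ}
    (hS : ∀ i y, HasDerivAt (S i) (η i y) y) (hη : ∀ i, ContDiff ℝ 1 (η i))
    (hη0 : ∀ i y, 0 ≤ η i y) (hη1 : ∀ y, ∑ i ∈ s, η i y ≤ 1) (hM : ∀ i y, |S i y| ≤ M)
    {w : ι → EuclideanSpace ℝ (Fin n) → EuclideanSpace ℝ (Fin n)}
    (hw : ∀ i, w i ∈ testFields φ) :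
    ∑ i ∈ s, derivPairing (fun x => S i (u x)) (w i) ≤ (tv φ u).toReal := by
  obtain ⟨U, hU, hlim, hle⟩ := exists_contDiff_tendsto hu htv
  have hSc (i) : ContDiff ℝ 1 (S i) := by
    rw [contDiff_one_iff_deriv, show deriv (S i) = η i from funext fun y => (hS i y).deriv]
    exact ⟨fun y => (hS i y).differentiableAt, (hη i).continuous⟩
  have htend : Tendsto (fun k => ∑ i ∈ s, derivPairing (fun x => S i (U k x)) (w i)) atTop
      (𝓝 (∑ i ∈ s, derivPairing (fun x => S i (u x)) (w i))) := by
    refine tendsto_finsetSum _ fun i _ => tendsto_derivPairing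
      (fun k => ((hSc i).comp (hU k)).continuous.aestronglyMeasurable) (fun k x => hM i _) ?_
      (hw i).1 (hw i).2.1
    filter_upwards [hlim] with x hx
    exact ((hSc i).continuous.tendsto _).comp hx
  refine le_of_tendsto' htend fun k => ?_
  -- The glued field depends on `k`, but its pairing with `U k` splits by the chain rule into
  -- pairings with the fixed `w i`, where the limit can be taken.
  have hV := sum_smul_mem_testFields hφ s (c := fun i x => η i (U k x)) (fun i _ => hw i)
    (fun i _ => (hη i).comp (hU k)) (fun i _ x => hη0 i _) (fun x => hη1 _)
  refine le_trans (le_of_eq ?_) (hle k _ hV)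
  rw [derivPairing_eq_integral_fderiv (hU k) hV.1 hV.2.1]
  have hd (i x) : fderiv ℝ (fun x => S i (U k x)) x = η i (U k x) • fderiv ℝ (U k) x :=
    ((hS i (U k x)).comp_hasFDerivAt x
      ((hU k).differentiable one_ne_zero x).hasFDerivAt).fderiv
  have hU' : Continuous (fderiv ℝ (U k)) := (hU k).continuous_fderiv one_ne_zero
  have hint (i) : Integrable (fun x => η i (U k x) * fderiv ℝ (U k) x (w i x)) volume := by
    have h1 := (hη i).continuous
    have h2 := (hU k).continuous
    have h3 := (hw i).1.continuous
    refine Continuous.integrable_of_hasCompactSupport (by fun_prop) ?_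
    refine HasCompactSupport.mono (f := w i) (hw i).2.1 fun x hx h => hx ?_
    simp [h]
  calc ∑ i ∈ s, derivPairing (fun x => S i (U k x)) (w i)
      = ∑ i ∈ s, ∫ x, η i (U k x) * fderiv ℝ (U k) x (w i x) := by
        refine Finset.sum_congr rfl fun i _ => ?_
        rw [derivPairing_eq_integral_fderiv (g := fun x => S i (U k x))
          ((hSc i).comp (hU k)) (hw i).1 (hw i).2.1]
        simp [hd]
    _ = _ := by
        rw [← integral_finsetSum _ fun i _ => hint i]
        simp [map_sum]

lemma sum_iSup_le_of_forall {ι α : Type*} [Nonempty α] (s : Finset ι) {F : ι → α → ℝ≥0∞}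
    {A : ℝ≥0∞} (h : ∀ x : ι → α, ∑ i ∈ s, F i (x i) ≤ A) : ∑ i ∈ s, ⨆ a, F i a ≤ A := by
  classical
  -- `B` carries the terms not yet replaced by suprema, so that the induction can free one index at
  -- a time.
  suffices H : ∀ B, (∀ x : ι → α, B + ∑ i ∈ s, F i (x i) ≤ A) → B + ∑ i ∈ s, ⨆ a, F i a ≤ A by
    simpa using H 0 (by simpa using h)
  clear h
  induction s using Finset.induction_on with
  | empty => intro B h; simpa using h fun _ => Classical.arbitrary α
  | insert i s hi ih =>
    intro B h
    rw [Finset.sum_insert hi, ← add_assoc, ENNReal.add_iSup, ENNReal.iSup_add]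
    refine iSup_le fun a => ih _ fun x => ?_
    have := h (update x i a)
    rw [Finset.sum_insert hi, update_self, ← add_assoc] at this
    convert this using 2
    exact Finset.sum_congr rfl fun j hj => by rw [update_of_ne (ne_of_mem_of_not_mem hj hi)]

lemma sum_tv_comp_le {ι : Type*} (hφ : IsAnisotropy φ) (hu : Integrable u volume)
    (htv : tv φ u ≠ ∞) (s : Finset ι) {S η : ι → ℝ → ℝ} {M : ℝ}
    (hS : ∀ i y, HasDerivAt (S i) (η i y) y) (hη : ∀ i, ContDiff ℝ 1 (η i))
    (hη0 : ∀ i y, 0 ≤ η i y) (hη1 : ∀ y, ∑ i ∈ s, η i y ≤ 1) (hM : ∀ i y, |S i y| ≤ M) :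
    ∑ i ∈ s, tv φ (fun x => S i (u x)) ≤ tv φ u := by
  have : Nonempty (testFields φ) := ⟨⟨0, zero_mem_testFields hφ⟩⟩
  simp_rw [tv, iSup_subtype' (p := fun v => v ∈ testFields φ)]
  refine sum_iSup_le_of_forall s fun w => ?_
  classical
  -- Fields with a negative pairing are replaced by 0, so that `ENNReal.ofReal` commutes with the
  -- sum.
  let w' : ι → testFields φ := fun i =>
    if 0 ≤ derivPairing (fun x => S i (u x)) (w i).1 then w i else ⟨0, zero_mem_testFields hφ⟩
  have h0 (i) : derivPairing (fun x => S i (u x)) (w' i).1 =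
      max (derivPairing (fun x => S i (u x)) (w i).1) 0 := by
    by_cases h : 0 ≤ derivPairing (fun x => S i (u x)) (w i).1
    · simp only [w', if_pos h, max_eq_left h]
    · simp only [w', if_neg h, max_eq_right (not_le.1 h).le]
      simp [derivPairing, divergence]
  have h1 (i) : ENNReal.ofReal (derivPairing (fun x => S i (u x)) (w i).1) =
      ENNReal.ofReal (derivPairing (fun x => S i (u x)) (w' i).1) := by
    rw [h0, ENNReal.ofReal_max, ENNReal.ofReal_zero, max_eq_left zero_le]
  simp_rw [h1]
  rw [← ENNReal.ofReal_sum_of_nonneg fun i _ => by rw [h0]; exact le_max_right _ _]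
  rw [← iSup_subtype' (p := fun v => v ∈ testFields φ)
    (f := fun v _ => ENNReal.ofReal (derivPairing u v))]
  change _ ≤ tv φ u
  rw [ENNReal.ofReal_le_iff_le_toReal htv]
  exact sum_derivPairing_comp_le hφ hu htv s hS hη hη0 hη1 hM fun i => (w' i).2

lemma tv_const_mul {r : ℝ} (hr : 0 ≤ r) :
    tv φ (fun x => r * g x) = ENNReal.ofReal r * tv φ g := by
  have h (v) : derivPairing (fun x => r * g x) v = r * derivPairing g v := by
    simp_rw [derivPairing, mul_assoc, integral_const_mul, mul_neg]
  simp_rw [tv, h, ENNReal.ofReal_mul hr, ENNReal.mul_iSup]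

lemma mul_sum_tv_smoothStep_le (hφ : IsAnisotropy φ) (hu : Integrable u volume)
    (htv : tv φ u ≠ ∞) {r : ℝ} (hr : 0 < r) (a : ℝ) (s : Finset ℤ) :
    ENNReal.ofReal r * ∑ i ∈ s, tv φ (fun x => smoothStep ((u x - (a + i * r)) / r)) ≤
      tv φ u := by
  rw [Finset.mul_sum]
  simp_rw [← tv_const_mul hr.le]
  have hη1 (y : ℝ) : ∑ i ∈ s, (Real.smoothTransition ((y - (a + (i : ℤ) * r)) / r) -
      Real.smoothTransition ((y - (a + i * r)) / r - 1)) ≤ 1 := by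
    have h (i : ℤ) : (y - (a + i * r)) / r = (y - a) / r - i := by field_simp; ring
    simp_rw [h]
    exact sum_smoothTransition_sub_le _ _
  refine sum_tv_comp_le hφ hu htv s
    (S := fun (i : ℤ) y => r * smoothStep ((y - (a + i * r)) / r)) (M := r)
    (fun i y => ?_) (fun i => ?_) (fun i y => ?_) hη1 fun i y => ?_
  · have h := ((hasDerivAt_smoothStep _).comp y
      (((hasDerivAt_id y).sub_const (a + i * r)).div_const r)).const_mul r
    refine h.congr_deriv ?_
    simp only [id]
    field_simp
  · have h : ContDiff ℝ 1 Real.smoothTransition := Real.smoothTransition.contDiff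
    fun_prop
  · exact sub_nonneg.2 (Real.smoothTransition.monotone (by linarith))
  · rw [abs_mul, abs_of_pos hr]
    exact mul_le_of_le_one_right hr.le (abs_smoothStep_le _)

/-- Cutting the line into intervals of length `r` and shifting them all to `(0, r]` turns the
integral into an average of Riemann sums over their offset. -/
lemma lintegral_le_of_forall_mul_sum_le {F : ℝ → ℝ≥0∞} (hF : Measurable F) {r : ℝ} (hr : 0 < r)
    {A : ℝ≥0∞} (h : ∀ (a : ℝ) (s : Finset ℤ), ENNReal.ofReal r * ∑ i ∈ s, F (a + i * r) ≤ A) :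
    ∫⁻ t, F t ≤ A := by
  have hr' : ENNReal.ofReal r ≠ 0 := by simpa using hr
  calc ∫⁻ t, F t = ∑' i : ℤ, ∫⁻ t in Set.Ioc (0 + i • r) (0 + (i + 1) • r), F t := by
        rw [← lintegral_iUnion (fun i => measurableSet_Ioc) (Set.pairwise_disjoint_Ioc_add_zsmul 0 r),
          iUnion_Ioc_add_zsmul hr, Measure.restrict_univ]
    _ = ∑' i : ℤ, ∫⁻ t in Set.Ioc 0 r, F (t + i * r) := by
        congr 1 with i
        rw [← (measurePreserving_add_right volume (i * r : ℝ)).setLIntegral_comp_preimage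
          measurableSet_Ioc hF]
        congr 2
        simp [add_mul]
    _ = ∫⁻ t in Set.Ioc 0 r, ∑' i : ℤ, F (t + i * r) :=
        (lintegral_tsum fun i => (hF.comp (measurable_add_const _)).aemeasurable).symm
    _ ≤ ∫⁻ t in Set.Ioc 0 r, A / ENNReal.ofReal r := by
        refine lintegral_mono fun t => ENNReal.summable.tsum_le_of_sum_le fun s => ?_
        rw [ENNReal.le_div_iff_mul_le (.inl hr') (.inl ENNReal.ofReal_ne_top), mul_comm]
        exact h t s
    _ = A := by
        rw [setLIntegral_const, Real.volume_Ioc, sub_zero,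
          ENNReal.div_mul_cancel hr' ENNReal.ofReal_ne_top]

/-! ### The coarea formula -/

/-- Read as a function of `t`, the characteristic function is that of a half-line; this is the form
used after exchanging integrals. -/
lemma chi_superlevel_apply (u : EuclideanSpace ℝ (Fin n) → ℝ) (t : ℝ)
    (x : EuclideanSpace ℝ (Fin n)) :
    chi (superlevel u t) x = (Set.Iio (u x)).indicator (fun _ => 1) t := by
  simp [chi, superlevel, Set.indicator_apply]

lemma abs_chi_le (A : Set (EuclideanSpace ℝ (Fin n))) (x : EuclideanSpace ℝ (Fin n)) :
    |chi A x| ≤ 1 := by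
  by_cases h : x ∈ A <;> simp [chi, h]

lemma measurable_uncurry_chi (hu : Measurable u) :
    Measurable (uncurry fun t x => chi (superlevel u t) x) := by
  have h : MeasurableSet {p : ℝ × EuclideanSpace ℝ (Fin n) | p.1 < u p.2} :=
    measurableSet_lt measurable_fst (hu.comp measurable_snd)
  exact (measurable_const (a := (1 : ℝ))).indicator h

lemma chi_superlevel_congr_ae (h : u =ᵐ[volume] g) (t : ℝ) :
    chi (superlevel u t) =ᵐ[volume] chi (superlevel g t) :=
  h.mono fun x hx => by simp [chi_superlevel_apply, hx]

lemma measurable_tv_chi (hu : Measurable u) :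
    Measurable fun t => tv φ (chi (superlevel u t)) :=
  measurable_tv (measurable_uncurry_chi hu) fun _ => abs_chi_le _

lemma lintegral_tv_chi_le (hφ : IsAnisotropy φ) (hum : Measurable u) (hu : Integrable u volume)
    (htv : tv φ u ≠ ∞) : ∫⁻ t, tv φ (chi (superlevel u t)) ≤ tv φ u := by
  let r : ℕ → ℝ := fun k => 1 / ((k : ℝ) + 1)
  have hr (k) : 0 < r k := by positivity
  have hr0 : Tendsto r atTop (𝓝 0) := tendsto_one_div_add_atTop_nhds_zero_nat
  have hmeas (k) : Measurable fun t => tv φ (fun x => smoothStep ((u x - t) / r k)) := by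
    refine measurable_tv (G := fun t x => smoothStep ((u x - t) / r k)) ?_
      fun t x => abs_smoothStep_le _
    exact continuous_smoothStep.measurable.comp
      (((hum.comp measurable_snd).sub measurable_fst).div_const _)
  calc ∫⁻ t, tv φ (chi (superlevel u t))
      ≤ ∫⁻ t, liminf (fun k => tv φ (fun x => smoothStep ((u x - t) / r k))) atTop := by
        refine lintegral_mono fun t => tv_le_liminf (fun k => ?_) (fun k x => abs_smoothStep_le _)
          (ae_of_all _ fun x => tendsto_smoothStep_div (u x) t hr hr0)
        exact (continuous_smoothStep.measurable.comp
          ((hum.sub_const t).div_const _)).aestronglyMeasurable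
    _ ≤ liminf (fun k => ∫⁻ t, tv φ (fun x => smoothStep ((u x - t) / r k))) atTop :=
        lintegral_liminf_le hmeas
    _ ≤ liminf (fun _ : ℕ => tv φ u) atTop := by
        refine liminf_le_liminf (Eventually.of_forall fun k => ?_)
        exact lintegral_le_of_forall_mul_sum_le (hmeas k) (hr k)
          (mul_sum_tv_smoothStep_le hφ hu htv (hr k))
    _ = tv φ u := liminf_const _

lemma indicator_Iio_sub_eq (a b t : ℝ) :
    (Set.Iio a).indicator (fun _ => (1 : ℝ)) t - (Set.Iio b).indicator (fun _ => 1) t =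
      (Set.Ico b a).indicator (fun _ => 1) t - (Set.Ico a b).indicator (fun _ => 1) t := by
  simp only [Set.indicator_apply, Set.mem_Iio, Set.mem_Ico]
  grind

lemma enorm_indicator_Iio_sub (a b t : ℝ) :
    ‖(Set.Iio a).indicator (fun _ => (1 : ℝ)) t - (Set.Iio b).indicator (fun _ => 1) t‖ₑ =
      (Set.Ico (min a b) (max a b)).indicator (fun _ => 1) t := by
  simp only [Set.indicator_apply, Set.mem_Iio, Set.mem_Ico, min_le_iff, lt_max_iff]
  rcases lt_or_ge t a with h1 | h1 <;> rcases lt_or_ge t b with h2 | h2 <;>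
    simp [h1, h2, not_lt.2, not_le.2]

lemma lintegral_enorm_indicator_Iio_sub (a b : ℝ) :
    ∫⁻ t, ‖(Set.Iio a).indicator (fun _ => (1 : ℝ)) t - (Set.Iio b).indicator (fun _ => 1) t‖ₑ =
      ‖a - b‖ₑ := by
  simp_rw [enorm_indicator_Iio_sub]
  rw [lintegral_indicator_const measurableSet_Ico, Real.volume_Ico, one_mul, max_sub_min_eq_abs,
    Real.enorm_eq_ofReal_abs, abs_sub_comm]

lemma integral_indicator_Iio_sub (a b : ℝ) :
    ∫ t, ((Set.Iio a).indicator (fun _ => (1 : ℝ)) t - (Set.Iio b).indicator (fun _ => 1) t) =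
      a - b := by
  have hi (c d : ℝ) : Integrable ((Set.Ico c d).indicator fun _ => (1 : ℝ)) volume :=
    (integrable_indicator_iff measurableSet_Ico).2 (by simp)
  simp_rw [indicator_Iio_sub_eq]
  rw [integral_sub (hi _ _) (hi _ _), integral_indicator_const _ measurableSet_Ico,
    integral_indicator_const _ measurableSet_Ico]
  simp only [Real.volume_real_Ico, smul_eq_mul, mul_one]
  grind

/-- Layer-cake formula for the pairing with the derivative. -/
lemma integrable_derivPairing_chi_and_integral_eq (hum : Measurable u)
    (hu : Integrable u volume) (hv : ContDiff ℝ 1 v) (hc : HasCompactSupport v) :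
    Integrable (fun t => derivPairing (chi (superlevel u t)) v) volume ∧
      derivPairing u v = ∫ t, derivPairing (chi (superlevel u t)) v := by
  -- For fixed `x`, `χ_{u>t}(x)` is not integrable in `t` at `-∞`. Subtracting the half-line `t < 0`
  -- leaves `L¹` norm `|u x|` in `t`, and does not affect the pairing because the divergence has
  -- integral zero.
  set K : EuclideanSpace ℝ (Fin n) → ℝ → ℝ := fun x t =>
    (chi (superlevel u t) x - (Set.Iio 0).indicator (fun _ => 1) t) * divergence v x with hK
  have hKm : Measurable (uncurry K) := by
    refine Measurable.mul (Measurable.sub ?_ ?_) ?_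
    · exact (measurable_uncurry_chi hum).comp measurable_swap
    · exact (measurable_const.indicator measurableSet_Iio).comp measurable_snd
    · exact (continuous_divergence hv).measurable.comp measurable_fst
  have hKi : Integrable (uncurry K) (volume.prod volume) := by
    refine ⟨hKm.aestronglyMeasurable, ?_⟩
    have h := (integrable_mul_divergence hu hv hc).2
    rw [HasFiniteIntegral] at h ⊢
    rw [lintegral_prod _ hKm.enorm.aemeasurable]
    refine lt_of_le_of_lt (le_of_eq (lintegral_congr fun x => ?_)) h
    simp only [uncurry, hK, enorm_mul, chi_superlevel_apply]
    rw [lintegral_mul_const' _ _ enorm_ne_top, lintegral_enorm_indicator_Iio_sub, sub_zero]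
  have h1 (t : ℝ) : derivPairing (chi (superlevel u t)) v = -∫ x, K x t := by
    have hi := integrable_divergence hv hc
    simp_rw [hK, sub_mul]
    rw [integral_sub, integral_const_mul, integral_divergence_eq_zero hv hc, mul_zero, sub_zero,
      derivPairing]
    · exact integrable_bdd_mul_divergence
        ((measurable_uncurry_chi hum).comp measurable_prodMk_left).aestronglyMeasurable
        (abs_chi_le _) hv hc
    · exact hi.const_mul _
  simp_rw [h1]
  refine ⟨hKi.integral_prod_right.neg, ?_⟩
  rw [integral_neg, ← integral_integral_swap hKi, derivPairing]
  congr 2 with x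
  simp_rw [hK, chi_superlevel_apply]
  rw [integral_mul_const, integral_indicator_Iio_sub, sub_zero]

lemma tv_le_lintegral_tv_chi (hum : Measurable u) (hu : Integrable u volume) :
    tv φ u ≤ ∫⁻ t, tv φ (chi (superlevel u t)) := by
  refine iSup₂_le fun v hv => ?_
  obtain ⟨hi, heq⟩ := integrable_derivPairing_chi_and_integral_eq hum hu hv.1 hv.2.1
  calc ENNReal.ofReal (derivPairing u v)
      ≤ ENNReal.ofReal (∫ t, max (derivPairing (chi (superlevel u t)) v) 0) := by
        rw [heq]
        exact ENNReal.ofReal_le_ofReal (integral_mono hi hi.pos_part fun t => le_max_left _ _)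
    _ = ∫⁻ t, ENNReal.ofReal (max (derivPairing (chi (superlevel u t)) v) 0) :=
        ofReal_integral_eq_lintegral_ofReal hi.pos_part (ae_of_all _ fun t => le_max_right _ _)
    _ ≤ ∫⁻ t, tv φ (chi (superlevel u t)) := by
        refine lintegral_mono fun t => ?_
        rw [ENNReal.ofReal_max, ENNReal.ofReal_zero, max_eq_left zero_le]
        exact ofReal_derivPairing_le_tv hv

/-! ### The fidelity term -/

lemma measurable_eLpNorm_chi_sub (hu : Measurable u) (hf : Measurable f) :
    Measurable fun t =>
      eLpNorm (fun x => chi (superlevel u t) x - chi (superlevel f t) x) 1 volume := by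
  simp_rw [eLpNorm_one_eq_lintegral_enorm]
  exact Measurable.lintegral_prod_right'
    ((measurable_uncurry_chi hu).sub (measurable_uncurry_chi hf)).enorm

lemma lintegral_eLpNorm_chi_sub (hu : Measurable u) (hf : Measurable f) :
    ∫⁻ t, eLpNorm (fun x => chi (superlevel u t) x - chi (superlevel f t) x) 1 volume =
      eLpNorm (fun x => u x - f x) 1 volume := by
  simp_rw [eLpNorm_one_eq_lintegral_enorm]
  rw [lintegral_lintegral_swap
    ((measurable_uncurry_chi hu).sub (measurable_uncurry_chi hf)).enorm.aemeasurable]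
  simp_rw [chi_superlevel_apply, lintegral_enorm_indicator_Iio_sub]

lemma nullMeasurableSet_superlevel (hu : AEStronglyMeasurable u volume) (t : ℝ) :
    NullMeasurableSet (superlevel u t) volume :=
  nullMeasurableSet_lt aemeasurable_const hu.aemeasurable

lemma eLpNorm_chi_sub_chi {A B : Set (EuclideanSpace ℝ (Fin n))}
    (hA : NullMeasurableSet A volume) (hB : NullMeasurableSet B volume) :
    eLpNorm (fun x => chi A x - chi B x) 1 volume = volume (A ∆ B) := by
  have h (x) : ‖chi A x - chi B x‖ₑ = (A ∆ B).indicator (fun _ => 1) x := by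
    by_cases hxA : x ∈ A <;> by_cases hxB : x ∈ B <;>
      simp [chi, Set.mem_symmDiff, hxA, hxB]
  simp_rw [eLpNorm_one_eq_lintegral_enorm, h]
  rw [lintegral_indicator_const₀ ?_, one_mul]
  exact (hA.diff hB).union (hB.diff hA)

lemma not_integrable_chi_superlevel [NeZero n] (hu : Integrable u volume) {t : ℝ} (ht : t < 0) :
    ¬ Integrable (chi (superlevel u t)) volume := by
  intro h
  have h1 : volume (superlevel u t) < ∞ :=
    (measure_mono fun x hx => by simp [chi, hx]).trans_lt (h.measure_norm_ge_lt_top one_pos)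
  have h2 : volume {x | -t ≤ ‖u x‖} < ∞ :=
    hu.measure_norm_ge_lt_top (neg_pos.2 ht)
  -- Where `u ≤ t < 0`, `|u|` is at least `-t`, so two sets of finite measure would cover the space.
  have h3 : Set.univ ⊆ superlevel u t ∪ {x | -t ≤ ‖u x‖} := fun x _ => by
    by_cases hx : u x > t
    · exact Or.inl hx
    · right
      rw [Set.mem_ofPred_eq, Real.norm_eq_abs]
      linarith [neg_abs_le (u x)]
  have h4 := (measure_mono h3).trans_lt
    ((measure_union_le _ _).trans_lt (ENNReal.add_lt_top.2 ⟨h1, h2⟩))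
  -- Positive dimension enters here: the space is noncompact, hence of infinite volume.
  rw [measure_univ_of_isAddLeftInvariant] at h4
  exact lt_irrefl _ h4

lemma energy_congr_ae {f' u' : EuclideanSpace ℝ (Fin n) → ℝ} (hu : u =ᵐ[volume] u')
    (hf : f =ᵐ[volume] f') (lam : ℝ) : energy φ u f lam = energy φ u' f' lam := by
  rw [energy, energy, tv_congr_ae hu, eLpNorm_congr_ae (hu.fun_sub hf)]

end AnisoTV

open AnisoTV in
theorem mainTheorem5 (n : ℕ) (hn : 1 ≤ n) (φ : EuclideanSpace ℝ (Fin n) → ℝ)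
    (hφ : AnisoTV.IsAnisotropy φ) (f u : EuclideanSpace ℝ (Fin n) → ℝ)
    (hf : Integrable f volume) (hu : AnisoTV.MemBV u) (lam : ℝ) (hlam : 0 < lam) :
    -- the layer-cake formula, between finite quantities and with a measurable integrand
    AEMeasurable (fun t : ℝ => AnisoTV.energy φ (AnisoTV.chi (AnisoTV.superlevel u t))
        (AnisoTV.chi (AnisoTV.superlevel f t)) lam) volume ∧
      AnisoTV.energy φ u f lam < ∞ ∧
      AnisoTV.energy φ u f lam =
        ∫⁻ t : ℝ, AnisoTV.energy φ (AnisoTV.chi (AnisoTV.superlevel u t))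
          (AnisoTV.chi (AnisoTV.superlevel f t)) lam ∧
      -- the characteristic functions are not integrable for negative `t`
      (∀ t : ℝ, t < 0 → ¬ Integrable (AnisoTV.chi (AnisoTV.superlevel u t)) volume) ∧
      -- but their distance is the measure of the symmetric difference, finite for almost every `t`
      (∀ t : ℝ, eLpNorm (fun x => AnisoTV.chi (AnisoTV.superlevel u t) x -
          AnisoTV.chi (AnisoTV.superlevel f t) x) 1 volume =
        volume (AnisoTV.superlevel u t ∆ AnisoTV.superlevel f t)) ∧
      ∀ᵐ t : ℝ, volume (AnisoTV.superlevel u t ∆ AnisoTV.superlevel f t) < ∞ := by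
  have : NeZero n := ⟨by omega⟩
  have hui : Integrable u volume := hu.1
  -- Borel representatives provide joint measurability in `(t, x)`; at every level the superlevel
  -- sets change only by null sets.
  obtain ⟨u', hu'm, huu'⟩ := hui.1.aemeasurable
  obtain ⟨f', hf'm, hff'⟩ := hf.1.aemeasurable
  have hui' : Integrable u' volume := hui.congr huu'
  have htv : tv φ u < ∞ := tv_lt_top_of_memBV hφ hu
  have hL1 : eLpNorm (fun x => u x - f x) 1 volume < ∞ :=
    (memLp_one_iff_integrable.2 (hui.sub hf)).2
  have hmeas := measurable_eLpNorm_chi_sub hu'm hf'm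
  have henergy (t : ℝ) : energy φ (chi (superlevel u t)) (chi (superlevel f t)) lam =
      energy φ (chi (superlevel u' t)) (chi (superlevel f' t)) lam :=
    energy_congr_ae (chi_superlevel_congr_ae huu' t) (chi_superlevel_congr_ae hff' t) lam
  have hdist (t : ℝ) : eLpNorm (fun x => chi (superlevel u t) x - chi (superlevel f t) x) 1 volume =
      volume (superlevel u t ∆ superlevel f t) :=
    eLpNorm_chi_sub_chi (nullMeasurableSet_superlevel hui.1 t)
      (nullMeasurableSet_superlevel hf.1 t)
  have hdist' (t : ℝ) :
      eLpNorm (fun x => chi (superlevel u' t) x - chi (superlevel f' t) x) 1 volume =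
        volume (superlevel u t ∆ superlevel f t) := by
    rw [← hdist]
    exact eLpNorm_congr_ae
      ((chi_superlevel_congr_ae huu' t).sub (chi_superlevel_congr_ae hff' t)).symm
  have hlayer := lintegral_eLpNorm_chi_sub hu'm hf'm
  rw [← eLpNorm_congr_ae (huu'.fun_sub hff')] at hlayer
  refine ⟨?_, ?_, ?_, fun t ht => not_integrable_chi_superlevel hui ht, hdist, ?_⟩
  · simp_rw [henergy, energy]
    exact ((measurable_tv_chi hu'm).add (hmeas.const_mul _)).aemeasurable
  · exact ENNReal.add_lt_top.2 ⟨htv, ENNReal.mul_lt_top ENNReal.ofReal_lt_top hL1⟩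
  · have hcoarea : tv φ u = ∫⁻ t, tv φ (chi (superlevel u' t)) := by
      rw [tv_congr_ae huu'] at htv ⊢
      exact (tv_le_lintegral_tv_chi hu'm hui').antisymm
        (lintegral_tv_chi_le hφ hu'm hui' htv.ne)
    simp_rw [henergy, energy]
    rw [lintegral_add_left (measurable_tv_chi hu'm), lintegral_const_mul _ hmeas, hlayer, hcoarea]
  · simp_rw [← hdist']
    exact ae_lt_top hmeas (by rw [hlayer]; exact hL1.ne)
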